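/- Let $k$ be a field of characteristic zero. By a connected graded Hopf algebra over $k$ we mean a Hopf algebra $H$ over $k$ (with respect to the ordinary, unsigned tensor product) with a grading $H=\bigoplus_{n\ge 0}H_n$ such that $H$ is both a graded algebra and a graded coalgebra, the antipode preserves the grading, and $H_0=k\cdot 1$. A graded Hopf subalgebra of $H$ is a subalgebra $K$ with $\Delta(K)\subseteq K\otimes K$, $S(K)\subseteq K$ and $K=\bigoplus_{n\ge 0}K_n$, where $K_n=K\cap H_n$. Let $H$ be a commutative connected graded Hopf algebra over $k$ and let $K$ be a graded Hopf subalgebra of $H$. Then $H$ is isomorphic, as a graded algebra over $K$, to the graded polynomial algebra over $K$ in some family of graded variables. That is, there are a set $\Gamma$, integers $d_\gamma\ge 1$ $(\gamma\in\Gamma)$ and an isomorphism of $K$-algebras $$e\colon K[x_\gamma \mid \gamma\in\Gamma]\longrightarrow H$$ such that, for every $n\ge 0$, $e$ maps the component of degree $n$ of $K[x_\gamma\mid\gamma\in\Gamma]$ onto $H_n$; here $K[x_\gamma\mid\gamma\in\Gamma]$ is graded by $\deg x_\gamma=d_\gamma$ and the given grading of $K$, i.e. its component of degree $n$ is the $k$-span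 of the terms $r\,x_{\gamma_1}\cdots x_{\gamma_s}$ with $r\in K_j$ and $j+d_{\gamma_1}+\cdots+d_{\gamma_s}=n$. -/

import Mathlib

universe u v

open scoped TensorProduct

/-- An `ℕ`-graded algebra `H = ⨁ 𝒜 n` that is a Hopf algebra is a *graded Hopf algebra* when it is
a graded coalgebra for the same grading and the antipode preserves the grading. (That `H` is a
graded algebra is the instance `GradedAlgebra 𝒜`.) -/
structure IsGradedHopfAlgebra {k H : Type*} [Field k] [Ring H] [HopfAlgebra k H]
    (𝒜 : ℕ → Submodule k H) [GradedAlgebra 𝒜] : Prop where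
  /-- `Δ(H_n) ⊆ ∑_{i + j = n} H_i ⊗ H_j`. -/
  comul_mem : ∀ n, ∀ x ∈ 𝒜 n, Coalgebra.comul (R := k) x ∈
    ⨆ p ∈ Finset.HasAntidiagonal.antidiagonal n,
      LinearMap.range (TensorProduct.map (𝒜 p.1).subtype (𝒜 p.2).subtype)
  /-- `ε(H_n) = 0` for `n ≠ 0`. -/
  counit_eq_zero : ∀ n, n ≠ 0 → ∀ x ∈ 𝒜 n, Coalgebra.counit (R := k) x = 0
  /-- `S(H_n) ⊆ H_n`. -/
  antipode_mem : ∀ n, ∀ x ∈ 𝒜 n, HopfAlgebra.antipode k x ∈ 𝒜 n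

/-- A *connected graded Hopf algebra*: a graded Hopf algebra whose degree zero part is `k · 1`. -/
structure IsConnectedGradedHopfAlgebra {k H : Type*} [Field k] [Ring H] [HopfAlgebra k H]
    (𝒜 : ℕ → Submodule k H) [GradedAlgebra 𝒜] : Prop extends IsGradedHopfAlgebra 𝒜 where
  zero_eq : 𝒜 0 = 1

/-- A *graded Hopf subalgebra*: a subalgebra that is a subcoalgebra, is stable under the antipode,
and contains the homogeneous components of each of its elements. -/
structure IsGradedHopfSubalgebra {k H : Type*} [Field k] [Ring H] [HopfAlgebra k H]
    (𝒜 : ℕ → Submodule k H) [GradedAlgebra 𝒜] (K : Subalgebra k H) : Prop where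
  /-- `Δ(K) ⊆ K ⊗ K`. -/
  comul_mem : ∀ x ∈ K, Coalgebra.comul (R := k) x ∈
    LinearMap.range (TensorProduct.map K.val.toLinearMap K.val.toLinearMap)
  /-- `S(K) ⊆ K`. -/
  antipode_mem : ∀ x ∈ K, HopfAlgebra.antipode k x ∈ K
  /-- `K = ⨁ (K ∩ H_n)`. -/
  homogeneous : ∀ x ∈ K, ∀ n, (DirectSum.decompose 𝒜 x n : H) ∈ K

/-- The grading `K_n = K ∩ H_n` induced on a subalgebra `K` of `H = ⨁ 𝒜 n`. -/
def Subalgebra.inducedGrading {k H : Type*} [Field k] [Ring H] [Algebra k H]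
    (𝒜 : ℕ → Submodule k H) (K : Subalgebra k H) (n : ℕ) : Submodule k K :=
  (𝒜 n).comap K.val.toLinearMap

/-- The grading of the polynomial algebra over a graded algebra `R = ⨁ ℬ n` in variables `X i` of
degrees `d i`: the component of degree `n` is spanned by the terms `r X^m` with `r ∈ ℬ j` and
`j + ∑ i, m i * d i = n`. -/
noncomputable def MvPolynomial.gradedVariables {k R ι : Type*} [Field k] [CommRing R] [Algebra k R]
    (ℬ : ℕ → Submodule k R) (d : ι → ℕ) (n : ℕ) : Submodule k (MvPolynomial ι R) :=
  Submodule.span k {p | ∃ (m : ι →₀ ℕ) (j : ℕ) (r : R),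
    r ∈ ℬ j ∧ j + Finsupp.weight d m = n ∧ p = MvPolynomial.monomial m r}

/-! ### Algebraic independence from a triangular Jacobian. -/

namespace MvPolynomial

variable {R A ι : Type*} [CommRing R] [CommRing A] [Algebra R A]

/-! Lift a homogeneous basis of the indecomposables of `H` relative to `K`. The lifts generate `H`
over `K` by induction on degree (`exists_aeval_generator_eq`). For independence, extend the
coordinate functional `f` of a generator of degree `n` by zero to `H`. It kills `K` and products of
positive-degree elements, so it is an ε-derivation, and `x ↦ ∑ x₁ f(x₂)` is a `K`-derivation of `H`.
On degrees at most `n`, connectedness makes this map the scalar `f x`. The Jacobian of the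
generators is thus unitriangular with respect to degree, and in characteristic zero differentiating
a relation of minimal total degree gives a contradiction
(`AlgebraicIndependent.of_triangular_derivations`). -/

theorem pderiv_ne_zero_of_mem_vars [IsAddTorsionFree R] {P : MvPolynomial ι R} {b : ι}
    (hb : b ∈ P.vars) : pderiv b P ≠ 0 := by
  classical
  obtain ⟨m, hm, hbm⟩ := (mem_vars_iff_mem_support b).1 hb
  intro h
  have h1 := coeff_pderiv (i := b) P (m - Finsupp.single b 1)
  have hle : Finsupp.single b 1 ≤ m := by
    rw [Finsupp.single_le_iff]
    exact Nat.one_le_iff_ne_zero.2 (Finsupp.mem_support_iff.1 hbm)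
  rw [h, coeff_zero, tsub_add_cancel_of_le hle] at h1
  have hmb : m b ≠ 0 := Finsupp.mem_support_iff.1 hbm
  have h2 : (m b) • coeff m P = 0 := by
    rw [nsmul_eq_mul, mul_comm, h1]
    congr 1
    have : ((m - Finsupp.single b 1 : ι →₀ ℕ) b) + 1 = m b := by
      simp only [Finsupp.coe_tsub, Pi.sub_apply, Finsupp.single_eq_same]; omega
    rw [← this]; push_cast; rfl
  exact mem_support_iff.1 hm ((smul_eq_zero_iff_right hmb).1 h2)

theorem totalDegree_pderiv_lt_of_mem_vars {P : MvPolynomial ι R} {b : ι}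
    (hb : b ∈ P.vars) : (pderiv b P).totalDegree < P.totalDegree := by
  classical
  have hpos : 0 < P.totalDegree := by
    obtain ⟨m, hm, hbm⟩ := (mem_vars_iff_mem_support b).1 hb
    refine lt_of_lt_of_le ?_ (le_totalDegree hm)
    exact lt_of_lt_of_le (Nat.pos_of_ne_zero (Finsupp.mem_support_iff.1 hbm))
      (Finset.single_le_sum (f := m) (fun _ _ => Nat.zero_le _) hbm)
  refine (Finset.sup_lt_iff hpos).2 fun m hm => ?_
  have hm' : m + Finsupp.single b 1 ∈ P.support := by
    rw [mem_support_iff] at hm ⊢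
    intro h
    exact hm (by rw [coeff_pderiv, h, zero_mul])
  have := le_totalDegree hm'
  rw [Finsupp.sum_add_index' (fun _ => rfl) (fun _ _ _ => rfl),
    Finsupp.sum_single_index rfl] at this
  omega

/-- The chain rule for a derivation that takes only the values `0` and `1` on the variables that
occur in `P`. -/
theorem derivation_aeval_eq_aeval_pderiv (D : Derivation R A A) (x : ι → A) (b : ι) (s : Set ι)
    (hb : D (x b) = 1) (hc : ∀ c ∈ s, c ≠ b → D (x c) = 0)
    {P : MvPolynomial ι R} (hP : P ∈ supported R s) :
    D (aeval x P) = aeval x (pderiv b P) := by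
  rw [supported_eq_adjoin_X] at hP
  induction hP using Algebra.adjoin_induction with
  | mem _ h =>
    obtain ⟨c, hcs, rfl⟩ := h
    by_cases hcb : c = b
    · subst hcb; simp [hb]
    · rw [aeval_X, hc c hcs hcb, pderiv_X_of_ne hcb, map_zero]
  | algebraMap r => simp [algebraMap_eq]
  | add p q _ _ hp hq => simp [hp, hq]
  | mul p q _ _ hp hq => simp [hp, hq, Derivation.leibniz]

/-- Elements are algebraically independent when there are derivations for which their Jacobian
matrix is unitriangular with respect to some rank function. -/
theorem _root_.AlgebraicIndependent.of_triangular_derivations [IsAddTorsionFree R]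
    (hinj : Function.Injective (algebraMap R A)) (x : ι → A) (d : ι → ℕ)
    (D : ι → Derivation R A A) (hb : ∀ b, D b (x b) = 1)
    (hc : ∀ b c, d c ≤ d b → c ≠ b → D b (x c) = 0) : AlgebraicIndependent R x := by
  rw [algebraicIndependent_iff]
  intro P
  induction hn : P.totalDegree using Nat.strong_induction_on generalizing P with
  | _ n ih =>
    subst hn
    intro hP
    by_cases hv : P.vars.Nonempty
    -- With `d b` maximal, `D b` kills every other variable of `P`, so it turns the relation `P`
    -- into the relation `pderiv b P`, which is nonzero and of smaller degree.
    · obtain ⟨b, hbv, hmax⟩ := P.vars.exists_max_image d hv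
      have h1 : aeval x (pderiv b P) = 0 := by
        rw [← derivation_aeval_eq_aeval_pderiv (D b) x b {c | d c ≤ d b} (hb b)
          (fun c hcb => hc b c hcb) (mem_supported.2 fun c hcv => hmax c hcv), hP, map_zero]
      exact absurd (ih _ (totalDegree_pderiv_lt_of_mem_vars hbv) _ rfl h1)
        (pderiv_ne_zero_of_mem_vars hbv)
    · rw [Finset.not_nonempty_iff_eq_empty, vars_eq_empty_iff_eq_C] at hv
      rw [hv, aeval_C, map_eq_zero_iff _ hinj] at hP
      rw [hv, hP, C_0]

section Grading

variable {k : Type*} [Field k] [Algebra k R] {ℬ : ℕ → Submodule k R} {d : ι → ℕ}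

theorem monomial_mem_gradedVariables {m : ι →₀ ℕ} {j n : ℕ} {r : R} (hr : r ∈ ℬ j)
    (h : j + Finsupp.weight d m = n) : monomial m r ∈ gradedVariables ℬ d n :=
  Submodule.subset_span ⟨m, j, r, hr, h, rfl⟩

theorem mul_mem_gradedVariables [SetLike.GradedMul ℬ] {i j : ℕ} {p q : MvPolynomial ι R}
    (hp : p ∈ gradedVariables ℬ d i) (hq : q ∈ gradedVariables ℬ d j) :
    p * q ∈ gradedVariables ℬ d (i + j) := by
  have hle : gradedVariables ℬ d i * gradedVariables ℬ d j ≤ gradedVariables ℬ d (i + j) := by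
    rw [gradedVariables, gradedVariables, Submodule.span_mul_span, Submodule.span_le]
    rintro _ ⟨_, ⟨m, a, r, hr, hm, rfl⟩, _, ⟨m', a', r', hr', hm', rfl⟩, rfl⟩
    dsimp only
    rw [monomial_mul]
    refine monomial_mem_gradedVariables (SetLike.mul_mem_graded hr hr') ?_
    rw [map_add]; omega
  exact hle (Submodule.mul_mem_mul hp hq)

end Grading

end MvPolynomial

/-! ### Derivations obtained by contracting the coproduct. -/

section Bialgebra

variable {k H : Type*} [Field k] [CommRing H] [Bialgebra k H]

/-- The map `x ↦ ∑ x₁ f(x₂)` attached to a linear functional `f`. -/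
noncomputable def LinearMap.contractRight (f : H →ₗ[k] k) : H →ₗ[k] H :=
  (TensorProduct.rid k H).toLinearMap ∘ₗ f.lTensor H ∘ₗ Coalgebra.comul

theorem LinearMap.contractRight_apply (f : H →ₗ[k] k) (x : H) :
    contractRight f x = TensorProduct.rid k H (f.lTensor H (Coalgebra.comul x)) := rfl

theorem LinearMap.counit_contractRight (f : H →ₗ[k] k) (x : H) :
    Coalgebra.counit (R := k) (contractRight f x) = f x := by
  have key : ∀ t : H ⊗[k] H, Coalgebra.counit (R := k) (TensorProduct.rid k H (f.lTensor H t)) =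
      f (TensorProduct.lid k H ((Coalgebra.counit (R := k)).rTensor H t)) := by
    intro t
    induction t with
    | zero => simp
    | add s t hs ht => simp only [map_add, hs, ht]
    | tmul a b => simp [mul_comm]
  rw [contractRight_apply, key, Coalgebra.rTensor_counit_comul]
  simp

/-- Multiplicativity of Δ lets the Leibniz rule of `f` act on second tensor factors; the counit
axiom collapses `∑ x₁ ε(x₂)` to `x`. -/
theorem LinearMap.contractRight_mul (f : H →ₗ[k] k)
    (hf : ∀ a b, f (a * b) = Coalgebra.counit a * f b + f a * Coalgebra.counit b) (x y : H) :
    LinearMap.contractRight f (x * y) =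
      x * LinearMap.contractRight f y + y * LinearMap.contractRight f x := by
  set ε := Coalgebra.counit (R := k) (A := H)
  have key : ∀ s t : H ⊗[k] H, TensorProduct.rid k H (f.lTensor H (s * t)) =
      TensorProduct.rid k H (ε.lTensor H s) * TensorProduct.rid k H (f.lTensor H t) +
      TensorProduct.rid k H (ε.lTensor H t) * TensorProduct.rid k H (f.lTensor H s) := by
    intro s t
    induction s with
    | zero => simp
    | add s₁ s₂ h₁ h₂ => simp only [map_add, add_mul, mul_add, h₁, h₂]; ring
    | tmul a b =>
      induction t with
      | zero => simp
      | add s₁ s₂ h₁ h₂ => simp only [map_add, add_mul, mul_add, h₁, h₂]; ring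
      | tmul a' b' =>
        simp only [Algebra.TensorProduct.tmul_mul_tmul, LinearMap.lTensor_tmul,
          TensorProduct.rid_tmul, hf, smul_mul_smul_comm, add_smul, mul_comm a' a, ε,
          mul_comm (f b)]
  rw [LinearMap.contractRight_apply, Bialgebra.comul_mul, key, Coalgebra.lTensor_counit_comul,
    Coalgebra.lTensor_counit_comul]
  simp [LinearMap.contractRight_apply]

theorem LinearMap.contractRight_eq_zero (f : H →ₗ[k] k) (K : Submodule k H)
    (hf : ∀ r ∈ K, f r = 0) {x : H}
    (hx : Coalgebra.comul x ∈ LinearMap.range (TensorProduct.map K.subtype K.subtype)) :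
    contractRight f x = 0 := by
  obtain ⟨t, ht⟩ := hx
  rw [contractRight_apply, ← ht]
  clear ht
  induction t with
  | zero => simp
  | add s t hs ht => simp only [map_add, hs, ht, add_zero]
  | tmul a b => simp [hf b b.2]

/-- The `K`-linear derivation `x ↦ ∑ x₁ f(x₂)` attached to an `ε`-derivation `f` that vanishes on
the subcoalgebra `K`. -/
noncomputable def LinearMap.contractRightDerivation (K : Subalgebra k H) (f : H →ₗ[k] k)
    (hf : ∀ a b, f (a * b) = Coalgebra.counit a * f b + f a * Coalgebra.counit b)
    (hfK : ∀ r ∈ K, f r = 0)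
    (hK : ∀ x ∈ K, Coalgebra.comul (R := k) x ∈
      LinearMap.range (TensorProduct.map K.val.toLinearMap K.val.toLinearMap)) :
    Derivation K H H :=
  Derivation.mk'
    { toFun := LinearMap.contractRight f
      map_add' := map_add _
      map_smul' := fun r x => by
        rw [Subalgebra.smul_def, smul_eq_mul, contractRight_mul f hf,
          LinearMap.contractRight_eq_zero f (Subalgebra.toSubmodule K) hfK (hK r r.2)]
        simp [Subalgebra.smul_def] }
    (fun a b => by simpa using contractRight_mul f hf a b)

@[simp]
theorem LinearMap.contractRightDerivation_apply (K : Subalgebra k H) (f : H →ₗ[k] k)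
    (hf : ∀ a b, f (a * b) = Coalgebra.counit a * f b + f a * Coalgebra.counit b)
    (hfK : ∀ r ∈ K, f r = 0)
    (hK : ∀ x ∈ K, Coalgebra.comul (R := k) x ∈
      LinearMap.range (TensorProduct.map K.val.toLinearMap K.val.toLinearMap)) (x : H) :
    contractRightDerivation K f hf hfK hK x = LinearMap.contractRight f x := rfl

end Bialgebra

/-! ### Triangularity from connectedness. -/

section GradedCoalgebra

variable {k H : Type*} [Field k] [CommRing H] [HopfAlgebra k H]
  {𝒜 : ℕ → Submodule k H} [GradedAlgebra 𝒜]

/-- Contraction of an element of degree at most `n` with a functional supported in degree `n` is a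
scalar. -/
theorem IsConnectedGradedHopfAlgebra.contractRight_eq (hH : IsConnectedGradedHopfAlgebra 𝒜)
    {m n : ℕ} (hmn : m ≤ n) (f : H →ₗ[k] k) (hf : ∀ j, j ≠ n → ∀ y ∈ 𝒜 j, f y = 0)
    {x : H} (hx : x ∈ 𝒜 m) : LinearMap.contractRight f x = algebraMap k H (f x) := by
  have h0 : LinearMap.contractRight f x ∈ 𝒜 0 := by
    have hle : (⨆ p ∈ Finset.HasAntidiagonal.antidiagonal m,
        LinearMap.range (TensorProduct.map (𝒜 p.1).subtype (𝒜 p.2).subtype)) ≤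
        (𝒜 0).comap ((TensorProduct.rid k H).toLinearMap ∘ₗ f.lTensor H) := by
      refine iSup₂_le fun p hp => ?_
      rintro _ ⟨t, rfl⟩
      induction t with
      | zero => simp
      | add s t hs ht => rw [map_add]; exact add_mem hs ht
      | tmul a b =>
        suffices f b • (a : H) ∈ 𝒜 0 by simpa using this
        -- Only terms with second factor of degree `n ≥ m` survive, which forces `m = n` and a first
        -- factor of degree zero.
        by_cases hj : p.2 = n
        · have h1 : p.1 = 0 := by have := Finset.HasAntidiagonal.mem_antidiagonal.1 hp; omega
          exact Submodule.smul_mem _ _ (h1 ▸ a.2)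
        · rw [hf _ hj _ b.2, zero_smul]; exact zero_mem _
    exact hle (hH.comul_mem m x hx)
  rw [hH.zero_eq] at h0
  obtain ⟨c, hc⟩ := Submodule.mem_one.1 h0
  -- The counit identifies the scalar.
  rw [← hc, ← LinearMap.counit_contractRight f x, ← hc]
  simp

end GradedCoalgebra

/-! ### Relative indecomposables and the generators. -/

section Indecomposables

variable {k H : Type*} [Field k] [CommRing H] [HopfAlgebra k H]
  (𝒜 : ℕ → Submodule k H) (K : Subalgebra k H)

/-- The elements of degree `n` that are decomposable relative to `K`: sums of products of elements
of positive degree and of elements of `K`. -/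
def relDecomposables (n : ℕ) : Submodule k H :=
  Submodule.span k {z | ∃ i j : ℕ, 0 < i ∧ 0 < j ∧ i + j = n ∧
    ∃ a ∈ 𝒜 i, ∃ b ∈ 𝒜 j, a * b = z} ⊔ (Subalgebra.toSubmodule K ⊓ 𝒜 n)

/-- The indecomposables of degree `n` relative to `K`. -/
abbrev RelIndecomposables (n : ℕ) : Type _ :=
  𝒜 n ⧸ (relDecomposables 𝒜 K n).comap (𝒜 n).subtype

variable [GradedAlgebra 𝒜]

/-- The functional on `H` induced by a functional on the relative indecomposables of degree `n`. -/
noncomputable def RelIndecomposables.functional {n : ℕ} (g : RelIndecomposables 𝒜 K n →ₗ[k] k) :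
    H →ₗ[k] k :=
  g ∘ₗ Submodule.mkQ _ ∘ₗ DirectSum.component k ℕ (fun i => 𝒜 i) n ∘ₗ
    (DirectSum.decomposeLinearEquiv 𝒜).toLinearMap

variable {𝒜 K} {n : ℕ} (g : RelIndecomposables 𝒜 K n →ₗ[k] k)

namespace RelIndecomposables

theorem functional_apply (x : H) :
    functional 𝒜 K g x = g (Submodule.Quotient.mk (DirectSum.decompose 𝒜 x n)) := rfl

theorem functional_coe (x : 𝒜 n) : functional 𝒜 K g x = g (Submodule.Quotient.mk x) := by
  rw [functional_apply, DirectSum.decompose_coe, DirectSum.of_eq_same]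

theorem functional_of_ne {m : ℕ} (hm : m ≠ n) {x : H} (hx : x ∈ 𝒜 m) :
    functional 𝒜 K g x = 0 := by
  have : DirectSum.decompose 𝒜 x n = 0 :=
    Subtype.ext (DirectSum.decompose_of_mem_ne 𝒜 hx hm)
  rw [functional_apply, this]
  simp

theorem functional_eq_zero {x : H} (hx : (DirectSum.decompose 𝒜 x n : H) ∈
    relDecomposables 𝒜 K n) : functional 𝒜 K g x = 0 := by
  have h : (Submodule.Quotient.mk (DirectSum.decompose 𝒜 x n) : RelIndecomposables 𝒜 K n) = 0 :=
    (Submodule.Quotient.mk_eq_zero _).2 hx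
  rw [functional_apply, h, map_zero]

theorem functional_eq_zero_of_mem (hK : IsGradedHopfSubalgebra 𝒜 K) {r : H} (hr : r ∈ K) :
    functional 𝒜 K g r = 0 :=
  functional_eq_zero g (Submodule.mem_sup_right ⟨hK.homogeneous r hr n, SetLike.coe_mem _⟩)

theorem functional_mul (hH : IsConnectedGradedHopfAlgebra 𝒜) (hK : IsGradedHopfSubalgebra 𝒜 K)
    (a b : H) : functional 𝒜 K g (a * b) =
      Coalgebra.counit a * functional 𝒜 K g b + functional 𝒜 K g a * Coalgebra.counit b := by
  have hscalar : ∀ x ∈ 𝒜 0, ∃ c : k, x = algebraMap k H c := fun x hx => by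
    rw [hH.zero_eq] at hx
    obtain ⟨c, hc⟩ := Submodule.mem_one.1 hx
    exact ⟨c, hc.symm⟩
  have hf : ∀ c : k, functional 𝒜 K g (algebraMap k H c) = 0 := fun c =>
    functional_eq_zero_of_mem g hK (K.algebraMap_mem c)
  induction a using DirectSum.Decomposition.inductionOn 𝒜 with
  | zero => simp
  | add a a' ha ha' => simp only [add_mul, map_add, ha, ha']; ring
  | @homogeneous i a =>
    induction b using DirectSum.Decomposition.inductionOn 𝒜 with
    | zero => simp
    | add b b' hb hb' => simp only [mul_add, map_add, hb, hb']; ring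
    | @homogeneous j b =>
      -- A degree-zero factor is a scalar, on which the functional vanishes since scalars lie in
      -- `K`; two factors of positive degree have a decomposable product and zero counits.
      rcases Nat.eq_zero_or_pos i with rfl | hi
      · obtain ⟨c, hc⟩ := hscalar a a.2
        rw [hc, hf, ← Algebra.smul_def]
        simp
      rcases Nat.eq_zero_or_pos j with rfl | hj
      · obtain ⟨c, hc⟩ := hscalar b b.2
        rw [hc, hf, mul_comm (a : H), ← Algebra.smul_def]
        simp [mul_comm]
      rw [hH.counit_eq_zero i hi.ne' a a.2, hH.counit_eq_zero j hj.ne' b b.2, zero_mul, mul_zero,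
        add_zero]
      have hab := SetLike.mul_mem_graded a.2 b.2
      by_cases hn : i + j = n
      · subst hn
        refine functional_eq_zero g ?_
        rw [DirectSum.decompose_of_mem_same 𝒜 hab]
        exact Submodule.mem_sup_left
          (Submodule.subset_span ⟨i, j, hi, hj, rfl, a, a.2, b, b.2, rfl⟩)
      · exact functional_of_ne g hn hab

variable (𝒜 K) in
/-- Indices of a homogeneous basis of the relative indecomposables. -/
abbrev Index : Type _ := Σ n, Module.Basis.ofVectorSpaceIndex k (RelIndecomposables 𝒜 K n)

/-- A basis element of the relative indecomposables. -/
noncomputable def basisElem (γ : Index 𝒜 K) : RelIndecomposables 𝒜 K γ.1 :=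
  Module.Basis.ofVectorSpace k _ γ.2

/-- A homogeneous lift of a basis element of the relative indecomposables. -/
noncomputable def generator (γ : Index 𝒜 K) : 𝒜 γ.1 :=
  Quotient.out (basisElem γ)

omit [GradedAlgebra 𝒜] in
theorem mk_generator (γ : Index 𝒜 K) :
    (Submodule.Quotient.mk (generator γ) : RelIndecomposables 𝒜 K γ.1) = basisElem γ :=
  Quotient.out_eq _

/-- The functional dual to a generator. -/
noncomputable abbrev dualFunctional (γ : Index 𝒜 K) : H →ₗ[k] k :=
  functional 𝒜 K ((Module.Basis.ofVectorSpace k (RelIndecomposables 𝒜 K γ.1)).coord γ.2)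

theorem dualFunctional_generator_self (γ : Index 𝒜 K) :
    dualFunctional γ (generator γ : H) = 1 := by
  rw [dualFunctional, functional_coe, mk_generator, basisElem, Module.Basis.coord_apply,
    Module.Basis.repr_self, Finsupp.single_eq_same]

theorem dualFunctional_generator_of_ne {γ δ : Index 𝒜 K} (h : δ ≠ γ) :
    dualFunctional γ (generator δ : H) = 0 := by
  obtain ⟨n, i⟩ := γ
  obtain ⟨m, j⟩ := δ
  by_cases hmn : m = n
  · subst hmn
    have hij : j ≠ i := fun hij => h (by rw [hij])
    refine (functional_coe _ (generator ⟨m, j⟩)).trans ?_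
    rw [mk_generator, basisElem, Module.Basis.coord_apply, Module.Basis.repr_self,
      Finsupp.single_eq_of_ne hij.symm]
  · exact functional_of_ne _ hmn (generator ⟨m, j⟩).2

/-- Degree zero consists of scalars, which lie in `K`, so the relative indecomposables vanish there.
-/
theorem index_pos (hH : IsConnectedGradedHopfAlgebra 𝒜) (γ : Index 𝒜 K) : 0 < γ.1 := by
  obtain ⟨n, i⟩ := γ
  rcases Nat.eq_zero_or_pos n with rfl | hn
  · exfalso
    refine (Module.Basis.ofVectorSpace k (RelIndecomposables 𝒜 K 0)).ne_zero i ?_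
    obtain ⟨y, hy⟩ := Submodule.Quotient.mk_surjective _
      (Module.Basis.ofVectorSpace k (RelIndecomposables 𝒜 K 0) i)
    rw [← hy, Submodule.Quotient.mk_eq_zero]
    refine Submodule.mem_sup_right ⟨?_, y.2⟩
    obtain ⟨c, hc⟩ := Submodule.mem_one.1 (hH.zero_eq.le y.2)
    change (y : H) ∈ K
    rw [← hc]
    exact K.algebraMap_mem c
  · exact hn

theorem algebraicIndependent_generator [CharZero k] (hH : IsConnectedGradedHopfAlgebra 𝒜)
    (hK : IsGradedHopfSubalgebra 𝒜 K) :
    AlgebraicIndependent K fun γ : Index 𝒜 K => (generator γ : H) := by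
  have : IsAddTorsionFree K := .of_isTorsionFree k K
  refine AlgebraicIndependent.of_triangular_derivations Subtype.val_injective _ Sigma.fst
    (fun γ => LinearMap.contractRightDerivation K (dualFunctional γ) (functional_mul _ hH hK)
      (fun r hr => functional_eq_zero_of_mem _ hK hr) hK.comul_mem) (fun γ => ?_)
    fun γ δ hle hne => ?_
  · rw [LinearMap.contractRightDerivation_apply, hH.contractRight_eq le_rfl _
      (fun j hj y hy => functional_of_ne _ hj hy) (generator γ).2,
      dualFunctional_generator_self, map_one]
  · rw [LinearMap.contractRightDerivation_apply, hH.contractRight_eq hle _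
      (fun j hj y hy => functional_of_ne _ hj hy) (generator δ).2,
      dualFunctional_generator_of_ne hne, map_zero]

end RelIndecomposables

instance Subalgebra.inducedGrading_gradedMul :
    SetLike.GradedMul (K.inducedGrading 𝒜) where
  mul_mem _ _ _ _ ha hb := SetLike.mul_mem_graded (A := 𝒜) ha hb

namespace RelIndecomposables

open MvPolynomial

theorem aeval_generator_mem {p : MvPolynomial (Index 𝒜 K) K}
    (hp : p ∈ gradedVariables (K.inducedGrading 𝒜) Sigma.fst n) :
    aeval (fun γ : Index 𝒜 K => (generator γ : H)) p ∈ 𝒜 n := by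
  induction hp using Submodule.span_induction with
  | mem _ h =>
    obtain ⟨m, j, r, hr, rfl, rfl⟩ := h
    rw [aeval_monomial]
    refine SetLike.mul_mem_graded (A := 𝒜) hr ?_
    rw [Finsupp.weight_apply]
    exact SetLike.prod_pow_mem_graded 𝒜 _ _ _ fun γ _ => (generator γ).2
  | zero => rw [map_zero]; exact zero_mem _
  | add p q _ _ hp hq => rw [map_add]; exact add_mem hp hq
  | smul c p _ hp =>
    rw [← algebraMap_smul K c p, map_smul, algebraMap_smul]
    exact Submodule.smul_mem _ c hp

theorem exists_aeval_generator_eq (n : ℕ) :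
    ∀ h ∈ 𝒜 n, ∃ p ∈ gradedVariables (K.inducedGrading 𝒜) Sigma.fst n,
      aeval (fun γ : Index 𝒜 K => (generator γ : H)) p = h := by
  induction n using Nat.strong_induction_on with
  | _ n ih =>
  let φ : MvPolynomial (Index 𝒜 K) K →ₗ[k] H :=
    (aeval fun γ : Index 𝒜 K => (generator γ : H)).toLinearMap.restrictScalars k
  let V : Submodule k H := (gradedVariables (K.inducedGrading 𝒜) Sigma.fst n).map φ
  have hdec : relDecomposables 𝒜 K n ≤ V := by
    refine sup_le (Submodule.span_le.2 ?_) ?_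
    · rintro _ ⟨i, j, hi, hj, rfl, a, ha, b, hb, rfl⟩
      obtain ⟨p, hp, rfl⟩ := ih i (by omega) a ha
      obtain ⟨q, hq, rfl⟩ := ih j (by omega) b hb
      exact ⟨p * q, mul_mem_gradedVariables hp hq, map_mul (aeval _) p q⟩
    · rintro r ⟨hrK, hr⟩
      exact ⟨monomial 0 ⟨r, hrK⟩, monomial_mem_gradedVariables (j := n) hr (by simp),
        aeval_C _ (⟨r, hrK⟩ : K)⟩
  intro h hh
  suffices hV : (⊤ : Submodule k (𝒜 n)) ≤ V.comap (𝒜 n).subtype from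
    hV (x := ⟨h, hh⟩) trivial
  let M := (relDecomposables 𝒜 K n).comap (𝒜 n).subtype
  have hM : M ≤ V.comap (𝒜 n).subtype := Submodule.comap_mono hdec
  -- `V` contains the decomposables, so it is determined by its image in the quotient, where hitting
  -- a basis suffices.
  have hker : ((V.comap (𝒜 n).subtype).map M.mkQ).comap M.mkQ = V.comap (𝒜 n).subtype := by
    rw [Submodule.comap_map_mkQ, sup_eq_right.2 hM]
  rw [← hker, ← Submodule.map_le_iff_le_comap, Submodule.map_top, Submodule.range_mkQ,
    ← (Module.Basis.ofVectorSpace k (RelIndecomposables 𝒜 K n)).span_eq, Submodule.span_le]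
  rintro _ ⟨i, rfl⟩
  refine ⟨generator ⟨n, i⟩, ⟨monomial (Finsupp.single ⟨n, i⟩ 1) 1,
    monomial_mem_gradedVariables (j := 0) ?_ (by simp [Finsupp.weight_single]), ?_⟩,
    mk_generator ⟨n, i⟩⟩
  · change (1 : H) ∈ 𝒜 0
    exact SetLike.one_mem_graded 𝒜
  · exact aeval_X _ _

end RelIndecomposables

end Indecomposables

open RelIndecomposables in
theorem mainTheorem6 {k : Type u} {H : Type v} [Field k] [CharZero k] [CommRing H]
    [HopfAlgebra k H] (𝒜 : ℕ → Submodule k H) [GradedAlgebra 𝒜]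
    (hH : IsConnectedGradedHopfAlgebra 𝒜)
    (K : Subalgebra k H) (hK : IsGradedHopfSubalgebra 𝒜 K) :
    ∃ (Γ : Type v) (d : Γ → ℕ) (e : MvPolynomial Γ K ≃ₐ[K] H),
      (∀ γ, 0 < d γ) ∧
      ∀ (n : ℕ) (p : MvPolynomial Γ K),
        p ∈ MvPolynomial.gradedVariables (K.inducedGrading 𝒜) d n ↔ e p ∈ 𝒜 n := by
  have hinj : Function.Injective
      (MvPolynomial.aeval (R := K) fun γ : Index 𝒜 K => (generator γ : H)) :=
    algebraicIndependent_generator hH hK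
  have hsurj : Function.Surjective
      (MvPolynomial.aeval (R := K) fun γ : Index 𝒜 K => (generator γ : H)) := by
    intro h
    induction h using DirectSum.Decomposition.inductionOn 𝒜 with
    | zero => exact ⟨0, map_zero _⟩
    | add a b ha hb =>
      obtain ⟨p, rfl⟩ := ha
      obtain ⟨q, rfl⟩ := hb
      exact ⟨p + q, map_add _ p q⟩
    | @homogeneous i a =>
      obtain ⟨p, -, hp⟩ := exists_aeval_generator_eq (K := K) i a a.2
      exact ⟨p, hp⟩
  refine ⟨Index 𝒜 K, Sigma.fst, AlgEquiv.ofBijective _ ⟨hinj, hsurj⟩, index_pos hH,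
    fun n p => ⟨aeval_generator_mem, fun hp => ?_⟩⟩
  -- The image of `p` also has a preimage of degree `n`, which equals `p` by injectivity.
  obtain ⟨q, hq, hqp⟩ := exists_aeval_generator_eq (K := K) n _ hp
  exact hinj hqp ▸ hq
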